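/- **Theorem 6.1 (Liouville-type theorem).** Let $a_1,a_2,\dots$ be an enumeration (without repetitions) of the lattice $\mathbb Z+i\mathbb Z\subset\mathbb C$, and let $\varepsilon_1\ge\varepsilon_2\ge\dots$ be positive numbers tending to $0$ so fast that $\sum_{k}\varepsilon_k\sqrt{|a_k|}<\infty$. For $n\ge 1$ put $$E_n:=\Big\{(z,w)\in\mathbb C^2:\ w=\sum_{k=1}^n\varepsilon_k\sqrt{z-a_k}\Big\},$$ where the right-hand side is multi-valued, i.e. $(z,w)\in E_n$ if and only if $w=\sum_{k=1}^n\varepsilon_k r_k$ for some $r_1,\dots,r_n\in\mathbb C$ with $r_k^2=z-a_k$ for every $k$. Let $$\mathcal E:=\lim_{n\to\infty}E_n=\Big\{b\in\mathbb C^2:\ \text{there are } b_n\in E_n\ (n\ge1)\text{ with } b=\lim_{n\to\infty}b_n\Big\}$$ be the associated Wermer-type set. Let $V\subset\mathbb C^2$ be an open set with $\mathcal E\subset V$, and let $\phi:V\to\mathbb R$ be a continuous plurisubharmonic function. If $\phi$ is bounded from above on $V$, then there is a constant $C\in\mathbb R$ such that $\phi(p)=C$ for all $p\in\mathcal E$.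 -/

import Mathlib

open Filter Topology

/-- `a` enumerates the lattice `ℤ + iℤ`: every lattice point is listed exactly once. -/
def IsLatticeEnumeration (a : ℕ → ℂ) : Prop :=
  Function.Injective a ∧
    Set.range a = {z : ℂ | ∃ m n : ℤ, z = (m : ℂ) + (n : ℂ) * Complex.I}

/-- The set `{w = ∑_{k < n} ε_k √(z - a_k)} ⊆ ℂ²`, where the square roots are multi-valued: all
`2 ^ n` independent choices of the roots `r k` are allowed. The sequences are indexed from `0`, so
that the first `n` terms are those with index `k < n`. -/
def partialWermerSet (a : ℕ → ℂ) (ε : ℕ → ℝ) (n : ℕ) : Set (ℂ × ℂ) :=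
  {p | ∃ r : ℕ → ℂ, (∀ k < n, r k ^ 2 = p.1 - a k) ∧
    p.2 = ∑ k ∈ Finset.range n, (ε k : ℂ) * r k}

/-- The Wermer type set `𝓔 = lim E_n`: all limits of convergent sequences `b_n ∈ E_n`. (The extra
set `E_0 = {w = 0}` is not empty, and so it has no influence on the limit.) -/
def wermerSet (a : ℕ → ℂ) (ε : ℕ → ℝ) : Set (ℂ × ℂ) :=
  {b | ∃ s : ℕ → ℂ × ℂ, (∀ n, s n ∈ partialWermerSet a ε n) ∧ Tendsto s atTop (𝓝 b)}

/-- A real-valued function `φ` is plurisubharmonic on `V ⊆ ℂ²` if it is upper semicontinuous there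
and satisfies the sub-mean value inequality
`φ(p) ≤ (1 / 2π) ∫_0^{2π} φ(p + e^{iθ} v) dθ`
on each closed affine complex disc `{p + t v : |t| ≤ 1}` contained in `V`. The integral is required
to be convergent, as it has to be when `φ(p) > -∞`. -/
def PlurisubharmonicOn (φ : ℂ × ℂ → ℝ) (V : Set (ℂ × ℂ)) : Prop :=
  UpperSemicontinuousOn φ V ∧
    ∀ p v : ℂ × ℂ, (∀ t : ℂ, ‖t‖ ≤ 1 → p + t • v ∈ V) →
      CircleIntegrable (fun t : ℂ => φ (p + t • v)) 0 1 ∧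
        φ p ≤ Real.circleAverage (fun t : ℂ => φ (p + t • v)) 0 1

/-! Write points of the limit set as $(z,\sum_k\varepsilon_k r_k)$ with $r_k^2=z-a_k$ for all $k$
(`wermerSet_eq_image`). The sums converge uniformly over bounded $z$, so the part of the set over a
closed disc is compact. Continuing the roots along $z=c+\zeta^2$ gives holomorphic curves inside the
set (`leafCurve`), on which $\phi$ obeys the strong maximum principle
(`PlurisubharmonicOn.eqOn_of_isPreconnected`). That principle is proved directly from sub-mean
values on affine discs, by a barrier argument in which the curve is compared with its tangent line.

The supremum is attained (`exists_isMaxOn_wermerSet`): boundedness of $\phi$ makes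
$\phi-\delta\log|z|$ small for large $|z|$, and the curves exclude a maximum in an annulus
$1<|z|<R$, so the maximum over $|z|\le1$ is global.

The value $C$ then spreads over the whole set. A generic $b$ sees every $a_k$ along a segment free
of other lattice points; going to the branch point $a_k$ and back on the other sheet changes the
sign of $r_k$ alone (`eq_of_flip`). Finitely many flips and a limit reach every point over $b$
(`eq_on_fiber`). The segments and small discs connect different base points (`eq_of_exists_eq`). -/

/-! ### Circle averages of squared moduli. -/

/-- The circle average of `‖f‖²` for holomorphic `f`. -/
theorem circleAverage_norm_sq_eq {f : ℂ → ℂ} (hf : DiffContOnCl ℂ f (Metric.ball 0 1)) :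
    Real.circleAverage (fun t => ‖f t‖ ^ 2) 0 1 =
      ‖f 0‖ ^ 2 + Real.circleAverage (fun t => ‖f t - f 0‖ ^ 2) 0 1 := by
  have hcont : ContinuousOn f (Metric.sphere 0 |1|) := by
    refine hf.continuousOn.mono ?_
    rw [closure_ball _ one_ne_zero, abs_one]
    exact Metric.sphere_subset_closedBall
  -- The cross term $2\,\mathrm{Re}(\overline{f(0)}(f-f(0)))$ of the expanded square averages to
  -- zero by the mean value property.
  have hmean : Real.circleAverage
      (fun t => (starRingEnd ℂ (f 0)) * (f t - f 0)) 0 1 = 0 := by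
    have h : DiffContOnCl ℂ (fun t => (starRingEnd ℂ (f 0)) • (f t - f 0))
        (Metric.ball 0 |1|) := by
      rw [abs_one]
      exact diffContOnCl_const.smul (hf.sub_const _)
    simpa using h.circleAverage
  have hre : Real.circleAverage
      (fun t => ((starRingEnd ℂ (f 0)) * (f t - f 0)).re) 0 1 = 0 := by
    have h := Complex.reCLM.circleAverage_comp_comm
      (f := fun t => (starRingEnd ℂ (f 0)) * (f t - f 0)) (c := 0) (R := 1)
      (ContinuousOn.circleIntegrable' (by fun_prop))
    rw [hmean] at h
    simpa [Function.comp_def] using h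
  have hexp : (fun t => ‖f t‖ ^ 2) = fun t =>
      (‖f 0‖ ^ 2 + ‖f t - f 0‖ ^ 2) + (2 : ℝ) • ((starRingEnd ℂ (f 0)) * (f t - f 0)).re := by
    funext t
    simp only [← Complex.normSq_eq_norm_sq, Complex.normSq_apply, Complex.sub_re, Complex.sub_im,
      Complex.mul_re, Complex.conj_re, Complex.conj_im, smul_eq_mul]
    ring
  rw [hexp, Real.circleAverage_fun_add, Real.circleAverage_fun_add, Real.circleAverage_fun_smul,
    hre, Real.circleAverage_const]
  · simp
  all_goals exact ContinuousOn.circleIntegrable' (by fun_prop)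

theorem diffContOnCl_comp_scale {f : ℂ → ℂ} {x : ℂ} (hf : ∀ᶠ z in 𝓝 x, DifferentiableAt ℂ f z) :
    ∀ᶠ r : ℝ in 𝓝[>] 0, DiffContOnCl ℂ (fun t : ℂ => f (x + r * t)) (Metric.ball 0 1) := by
  obtain ⟨ρ, hρ, h⟩ := Metric.eventually_nhds_iff_ball.1 hf
  filter_upwards [Ioo_mem_nhdsGT hρ] with r hr
  have hd : DifferentiableOn ℂ (fun t : ℂ => f (x + r * t)) (Metric.closedBall 0 1) := by
    intro t ht
    refine DifferentiableAt.differentiableWithinAt ?_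
    have hmem : x + r * t ∈ Metric.ball x ρ := by
      rw [mem_closedBall_zero_iff] at ht
      simp only [mem_ball_iff_norm, add_sub_cancel_left, norm_mul, Complex.norm_real,
        Real.norm_eq_abs, abs_of_pos hr.1]
      nlinarith [hr.1, hr.2]
    exact (h _ hmem).comp t (by fun_prop : DifferentiableAt ℂ (fun t : ℂ => x + r * t) t)
  refine DifferentiableOn.diffContOnCl ?_
  rwa [closure_ball _ one_ne_zero]

theorem eventually_scale {p : ℂ → Prop} (h : ∀ᶠ t in 𝓝 (0 : ℂ), p t) :
    ∀ᶠ r : ℝ in 𝓝[>] 0, ∀ t : ℂ, ‖t‖ ≤ 1 → p (r * t) := by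
  obtain ⟨ρ, hρ, h⟩ := Metric.eventually_nhds_iff_ball.1 h
  filter_upwards [Ioo_mem_nhdsGT hρ] with r hr t ht
  refine h _ ?_
  simp only [mem_ball_zero_iff, norm_mul, Complex.norm_real, Real.norm_eq_abs, abs_of_pos hr.1]
  nlinarith [hr.1, hr.2]

theorem circleIntegrable_norm_sub_sq {f : ℂ → ℂ} (hf : DiffContOnCl ℂ f (Metric.ball 0 1)) (c : ℂ) :
    CircleIntegrable (fun t => ‖f t - c‖ ^ 2) 0 1 := by
  have hcont : ContinuousOn f (Metric.sphere 0 |1|) := by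
    refine hf.continuousOn.mono ?_
    rw [closure_ball _ one_ne_zero, abs_one]
    exact Metric.sphere_subset_closedBall
  exact ContinuousOn.circleIntegrable' (by fun_prop)

/-- At a critical point $f(x+rt)-f(x)=o(r)$, so the average of the squared modulus grows by only
$o(r^2)$. At a noncritical point the growth is of exact order $r^2$; this gap drives the barrier
argument. -/
theorem eventually_circleAverage_norm_sq_le {f : ℂ → ℂ} {x : ℂ}
    (hf : ∀ᶠ z in 𝓝 x, DifferentiableAt ℂ f z) (hf' : deriv f x = 0) {e : ℝ} (he : 0 < e) :
    ∀ᶠ r : ℝ in 𝓝[>] 0,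
      Real.circleAverage (fun t : ℂ => ‖f (x + r * t)‖ ^ 2) 0 1 ≤ ‖f x‖ ^ 2 + e * r ^ 2 := by
  have hd := hf.self_of_nhds.hasDerivAt
  rw [hf', hasDerivAt_iff_isLittleO_nhds_zero] at hd
  have hs := eventually_scale (hd.def (Real.sqrt_pos.2 he))
  filter_upwards [hs, diffContOnCl_comp_scale hf, self_mem_nhdsWithin] with r h1 h2 (h3 : 0 < r)
  rw [circleAverage_norm_sq_eq h2]
  simp only [mul_zero, add_zero]
  gcongr
  refine Real.circleAverage_mono_on_of_le_circle (circleIntegrable_norm_sub_sq h2 _) ?_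
  intro t ht
  have ht' : ‖t‖ = 1 := by simpa using ht
  have h := h1 t ht'.le
  simp only [smul_zero, sub_zero, norm_mul, Complex.norm_real, Real.norm_eq_abs, abs_of_pos h3, ht',
    mul_one] at h
  calc ‖f (x + r * t) - f x‖ ^ 2 ≤ (√e * r) ^ 2 := by gcongr
    _ = e * r ^ 2 := by rw [mul_pow, Real.sq_sqrt he.le]

theorem eventually_le_circleAverage_norm_sq {f : ℂ → ℂ} {x : ℂ}
    (hf : ∀ᶠ z in 𝓝 x, DifferentiableAt ℂ f z) (hf' : deriv f x ≠ 0) :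
    ∃ κ > 0, ∀ᶠ r : ℝ in 𝓝[>] 0,
      ‖f x‖ ^ 2 + κ * r ^ 2 ≤ Real.circleAverage (fun t : ℂ => ‖f (x + r * t)‖ ^ 2) 0 1 := by
  have hd := hf.self_of_nhds.hasDerivAt
  rw [hasDerivAt_iff_isLittleO_nhds_zero] at hd
  have hpos : 0 < ‖deriv f x‖ / 2 := by positivity
  refine ⟨(‖deriv f x‖ / 2) ^ 2, by positivity, ?_⟩
  have hs := eventually_scale (hd.def hpos)
  filter_upwards [hs, diffContOnCl_comp_scale hf, self_mem_nhdsWithin] with r h1 h2 (h3 : 0 < r)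
  rw [circleAverage_norm_sq_eq h2]
  simp only [mul_zero, add_zero]
  gcongr
  rw [← Real.circleAverage_const ((‖deriv f x‖ / 2) ^ 2 * r ^ 2) 0 1]
  refine Real.circleAverage_mono (ContinuousOn.circleIntegrable' continuousOn_const)
    (circleIntegrable_norm_sub_sq h2 _) ?_
  intro t ht
  have ht' : ‖t‖ = 1 := by simpa using ht
  have h := h1 t ht'.le
  have hn : ‖(r * t : ℂ)‖ = r := by simp [ht', abs_of_pos h3]
  have htri := norm_sub_norm_le ((r * t : ℂ) • deriv f x)
    ((r * t : ℂ) • deriv f x - (f (x + r * t) - f x))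
  rw [sub_sub_cancel, norm_sub_rev _ (f (x + r * t) - f x), norm_smul, hn] at htri
  rw [hn] at h
  rw [← mul_pow]
  have : ‖deriv f x‖ / 2 * r ≤ ‖f (x + r * t) - f x‖ := by linarith
  gcongr

/-! ### The strong maximum principle along holomorphic curves. -/

/-- A plurisubharmonic function, penalised by the squared distance to a holomorphic curve and
increased by the squared modulus of a holomorphic function that is not critical, has no local maximum in
the direction of the curve. -/
theorem PlurisubharmonicOn.not_eventually_le {φ : ℂ × ℂ → ℝ} {V : Set (ℂ × ℂ)} (hV : IsOpen V)
    (hφ : PlurisubharmonicOn φ V) {H : ℂ → ℂ × ℂ} {g : ℂ → ℂ} {x : ℂ} {y : ℂ × ℂ} (hy : y ∈ V)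
    (hH : ∀ᶠ z in 𝓝 x, DifferentiableAt ℂ H z) (hg : ∀ᶠ z in 𝓝 x, DifferentiableAt ℂ g z)
    (hg' : deriv g x ≠ 0) {N η : ℝ} (hN : 0 < N) (hη : 0 < η) :
    ¬ ∀ᶠ t in 𝓝 (0 : ℂ),
      φ (y + t • deriv H x) - N * (‖(y + t • deriv H x - H (x + t)).1‖ ^ 2
        + ‖(y + t • deriv H x - H (x + t)).2‖ ^ 2) + η * ‖g (x + t)‖ ^ 2 ≤
      φ y - N * (‖(y - H x).1‖ ^ 2 + ‖(y - H x).2‖ ^ 2) + η * ‖g x‖ ^ 2 := by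
  intro hmax
  set v := deriv H x with hv
  have hHx := hH.self_of_nhds.hasDerivAt
  -- The tangent direction `v` makes `x` a critical point of the difference between line and curve,
  -- so the penalty costs only $o(r^2)$.
  set G₁ : ℂ → ℂ := fun z => (y + (z - x) • v - H z).1 with hG₁
  set G₂ : ℂ → ℂ := fun z => (y + (z - x) • v - H z).2 with hG₂
  have hdG : ∀ᶠ z in 𝓝 x, DifferentiableAt ℂ (fun z => y + (z - x) • v - H z) z := by
    filter_upwards [hH] with z hz
    exact DifferentiableAt.sub (by fun_prop) hz
  have hder : HasDerivAt (fun z => y + (z - x) • v - H z) 0 x := by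
    have h := (((hasDerivAt_id x).sub_const x).smul_const v).const_add y |>.sub hHx
    rw [one_smul, ← hv, sub_self] at h
    exact h
  have hG₁d : ∀ᶠ z in 𝓝 x, DifferentiableAt ℂ G₁ z := hdG.mono fun z hz => hz.fst
  have hG₂d : ∀ᶠ z in 𝓝 x, DifferentiableAt ℂ G₂ z := hdG.mono fun z hz => hz.snd
  have hG₁' : deriv G₁ x = 0 := (HasFDerivAt.hasDerivAt (HasFDerivAt.fst hder)).deriv.trans (by simp)
  have hG₂' : deriv G₂ x = 0 := (HasFDerivAt.hasDerivAt (HasFDerivAt.snd hder)).deriv.trans (by simp)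
  obtain ⟨κ, hκ, hgκ⟩ := eventually_le_circleAverage_norm_sq hg hg'
  -- The two penalty terms then cost at most $\eta\kappa r^2/4$ each, less together than the gain
  -- $\eta\kappa r^2$ from `g`.
  have he : 0 < η * κ / (4 * N) := by positivity
  have hVt : ∀ᶠ t in 𝓝 (0 : ℂ), y + t • v ∈ V := by
    have : ContinuousAt (fun t : ℂ => y + t • v) 0 := by fun_prop
    exact this.eventually_mem (hV.mem_nhds (by simpa using hy))
  obtain ⟨r, h1, h2, h3, h4, h5, h6, h7, h8, hr⟩ := ((eventually_circleAverage_norm_sq_le hG₁d hG₁' he).and <|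
    (eventually_circleAverage_norm_sq_le hG₂d hG₂' he).and <| hgκ.and <|
    (eventually_scale hVt).and <| (eventually_scale hmax).and <| (diffContOnCl_comp_scale hG₁d).and
    <| (diffContOnCl_comp_scale hG₂d).and <| (diffContOnCl_comp_scale hg).and
      self_mem_nhdsWithin).exists
  have hr : 0 < r := hr
  obtain ⟨hint, hle⟩ := hφ.2 y ((r : ℂ) • v) (by
    intro t ht
    rw [smul_smul, mul_comm]
    exact h4 t ht)
  have i1 : CircleIntegrable (fun t : ℂ => ‖G₁ (x + r * t)‖ ^ 2) 0 1 := by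
    simpa using circleIntegrable_norm_sub_sq h6 0
  have i2 : CircleIntegrable (fun t : ℂ => ‖G₂ (x + r * t)‖ ^ 2) 0 1 := by
    simpa using circleIntegrable_norm_sub_sq h7 0
  have i3 : CircleIntegrable (fun t : ℂ => ‖g (x + r * t)‖ ^ 2) 0 1 := by
    simpa using circleIntegrable_norm_sub_sq h8 0
  have i4 : CircleIntegrable (fun t : ℂ => η • ‖g (x + r * t)‖ ^ 2) 0 1 := i3.const_smul
  have i5 : CircleIntegrable (fun t : ℂ =>
    N • (‖G₁ (x + r * t)‖ ^ 2 + ‖G₂ (x + r * t)‖ ^ 2)) 0 1 := (i1.add i2).const_smul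
  have key : Real.circleAverage (fun t : ℂ => φ (y + t • ((r : ℂ) • v)) + η • ‖g (x + r * t)‖ ^ 2) 0 1
      ≤ Real.circleAverage (fun t : ℂ => (φ y - N * (‖(y - H x).1‖ ^ 2 + ‖(y - H x).2‖ ^ 2)
        + η * ‖g x‖ ^ 2) + N • (‖G₁ (x + r * t)‖ ^ 2 + ‖G₂ (x + r * t)‖ ^ 2)) 0 1 := by
    refine Real.circleAverage_mono (hint.add i4) (CircleIntegrable.add
      (ContinuousOn.circleIntegrable' continuousOn_const) i5) ?_
    intro t ht
    have ht' : ‖t‖ = 1 := by simpa using ht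
    have h := h5 t ht'.le
    simp only [hG₁, hG₂, smul_eq_mul, add_sub_cancel_left, smul_smul, mul_comm t (r : ℂ)] at h ⊢
    linarith
  rw [Real.circleAverage_fun_add hint i4, Real.circleAverage_fun_smul,
    Real.circleAverage_fun_add (ContinuousOn.circleIntegrable' continuousOn_const)
      i5, Real.circleAverage_const, Real.circleAverage_fun_smul,
    Real.circleAverage_fun_add i1 i2] at key
  have e1 : ‖G₁ x‖ = ‖(y - H x).1‖ := by simp [hG₁]
  have e2 : ‖G₂ x‖ = ‖(y - H x).2‖ := by simp [hG₂]
  rw [e1] at h1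
  rw [e2] at h2
  simp only [smul_eq_mul] at key
  have k1 := mul_le_mul_of_nonneg_left h1 hN.le
  have k2 := mul_le_mul_of_nonneg_left h2 hN.le
  have k3 := mul_le_mul_of_nonneg_left h3 hη.le
  have k4 : N * (η * κ / (4 * N) * r ^ 2) = η * κ * r ^ 2 / 4 := by field_simp
  have k5 : 0 < η * κ * r ^ 2 := by positivity
  nlinarith

/-- Strong maximum principle along a holomorphic curve, on discs: if `φ ∘ H ≤ C` on a closed disc
and the inequality is strict at the centre, then it is strict in the open disc. -/
theorem PlurisubharmonicOn.lt_of_center_lt {φ : ℂ × ℂ → ℝ} {V : Set (ℂ × ℂ)} (hV : IsOpen V)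
    (hφc : ContinuousOn φ V) (hφ : PlurisubharmonicOn φ V) {H : ℂ → ℂ × ℂ} {Ω : Set ℂ}
    (hΩ : IsOpen Ω) (hH : DifferentiableOn ℂ H Ω) (hHV : Set.MapsTo H Ω V) {z₁ : ℂ} {R C : ℝ}
    (hR : Metric.closedBall z₁ R ⊆ Ω) (hle : ∀ z ∈ Metric.closedBall z₁ R, φ (H z) ≤ C)
    (hlt : φ (H z₁) < C) : ∀ z ∈ Metric.ball z₁ R, φ (H z) < C := by
  intro ζ₀ hζ₀
  by_contra! hge
  have hR0 : 0 < R := Metric.nonempty_ball.1 ⟨_, hζ₀⟩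
  have hz₁Ω : z₁ ∈ Ω := hR (Metric.mem_closedBall_self hR0.le)
  have hcu : ContinuousOn (φ ∘ H) Ω := hφc.comp hH.continuousOn hHV
  have hcHat : ∀ z ∈ Ω, ContinuousAt H z := fun z hz => hH.continuousOn.continuousAt (hΩ.mem_nhds hz)
  obtain ⟨κ, hκ, hκ'⟩ : ∃ κ > 0, φ (H z₁) < C - κ :=
    ⟨(C - φ (H z₁)) / 2, by linarith, by linarith⟩
  obtain ⟨ρ, hρ, hρ'⟩ : ∃ ρ > 0, ∀ z, ‖z - z₁‖ ≤ ρ → φ (H z) < C - κ := by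
    have h : ∀ᶠ z in 𝓝 z₁, φ (H z) < C - κ :=
      (hcu.continuousAt (hΩ.mem_nhds hz₁Ω)).eventually_lt_const hκ'
    obtain ⟨ρ, hρ, h⟩ := Metric.nhds_basis_closedBall.eventually_iff.1 h
    exact ⟨ρ, hρ, fun z hz => h (mem_closedBall_iff_norm.2 hz)⟩
  rw [mem_ball_iff_norm] at hζ₀
  have hρζ : ρ < ‖ζ₀ - z₁‖ := by
    by_contra! h
    linarith [hρ' _ h]
  set A : Set ℂ := {z | ρ ≤ ‖z - z₁‖ ∧ ‖z - z₁‖ ≤ R} with hA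
  have hAR : A ⊆ Metric.closedBall z₁ R := fun z hz => mem_closedBall_iff_norm.2 hz.2
  have hAΩ : A ⊆ Ω := hAR.trans hR
  have hAc : IsCompact A := by
    refine (isCompact_closedBall z₁ R).of_isClosed_subset ?_ hAR
    have hn : Continuous fun z : ℂ => ‖z - z₁‖ := by fun_prop
    exact (isClosed_le continuous_const hn).inter (isClosed_le hn continuous_const)
  -- Barrier on the annulus: `η * ‖g z‖ ^ 2` is at most `κ` there and decreases with the distance
  -- from `z₁`.
  set g : ℂ → ℂ := fun z => (z - z₁)⁻¹ with hg
  set η := κ * ρ ^ 2 with hηdef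
  have hη : 0 < η := by positivity
  have hgn : ∀ z, ‖g z‖ ^ 2 = 1 / ‖z - z₁‖ ^ 2 := fun z => by simp [hg]
  have hgA : ∀ z ∈ A, η * ‖g z‖ ^ 2 ≤ κ := by
    intro z hz
    rw [hgn, hηdef, mul_assoc, mul_one_div]
    refine mul_le_of_le_one_right hκ.le ((div_le_one ?_).2 ?_)
    · have := hρ.trans_le hz.1
      positivity
    · have := hz.1
      gcongr
  -- `s` is the excess of the barrier at `ζ₀` over its value on the outer circle.
  obtain ⟨s, hs, hsη⟩ : ∃ s > 0, η / R ^ 2 + s = η * ‖g ζ₀‖ ^ 2 := by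
    refine ⟨η * ‖g ζ₀‖ ^ 2 - η / R ^ 2, ?_, by ring⟩
    rw [hgn, mul_one_div, gt_iff_lt, sub_pos]
    have := hρ.trans hρζ
    gcongr
  have hK : IsCompact (H '' A) := hAc.image_of_continuousOn (hH.continuousOn.mono hAΩ)
  have hKV : H '' A ⊆ V := (hHV.mono_left hAΩ).image_subset
  obtain ⟨δ, hδ, hδV, hδφ⟩ : ∃ δ > 0, (∀ z ∈ A, ∀ w : ℂ × ℂ, ‖w‖ ≤ δ → H z + w ∈ V) ∧
      ∀ z ∈ A, ∀ w : ℂ × ℂ, ‖w‖ ≤ δ → φ (H z + w) < φ (H z) + s := by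
    obtain ⟨δ₁, hδ₁, h₁⟩ := hK.exists_cthickening_subset_open hV hKV
    have h := hK.uniformContinuousAt_of_continuousAt φ
      (fun p hp => hφc.continuousAt (hV.mem_nhds (hKV hp))) (Metric.dist_mem_uniformity hs)
    obtain ⟨δ₂, hδ₂, h₂⟩ := Metric.mem_uniformity_dist.1 h
    refine ⟨min δ₁ (δ₂ / 2), by positivity, fun z hz w hw => h₁ ?_, fun z hz w hw => ?_⟩
    · refine Metric.mem_cthickening_of_dist_le _ (H z) _ _ (Set.mem_image_of_mem H hz) ?_
      simpa using hw.trans (min_le_left _ _)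
    · have hd : dist (H z) (H z + w) < δ₂ := by
        have := hw.trans (min_le_right _ _)
        rw [dist_self_add_right]
        linarith
      have h3 := h₂ hd (Set.mem_image_of_mem H hz)
      simp only [Set.mem_ofPred_eq, Real.dist_eq] at h3
      linarith [(abs_lt.1 h3).1]
  -- At `‖w‖ = δ` the penalty outweighs both the possible increase `s` of `φ` and the barrier bound
  -- `κ`.
  obtain ⟨N, hN, hNδ⟩ : ∃ N > 0, N * δ ^ 2 = s + κ + 1 :=
    ⟨(s + κ + 1) / δ ^ 2, by positivity, by field_simp⟩
  set Ψ : ℂ × (ℂ × ℂ) → ℝ := fun q =>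
    φ (H q.1 + q.2) - N * (‖q.2.1‖ ^ 2 + ‖q.2.2‖ ^ 2) + η * ‖g q.1‖ ^ 2 with hΨ
  have hAne : ∀ z ∈ A, z - z₁ ≠ 0 := fun z hz => norm_pos_iff.1 (hρ.trans_le hz.1)
  have hΨc : ContinuousOn Ψ (A ×ˢ Metric.closedBall 0 δ) := by
    have c1 : ContinuousOn (fun q : ℂ × (ℂ × ℂ) => H q.1 + q.2) (A ×ˢ Metric.closedBall 0 δ) :=
      ((hH.continuousOn.mono hAΩ).comp continuousOn_fst fun q hq => hq.1).add continuousOn_snd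
    have c2 : ContinuousOn (fun q : ℂ × (ℂ × ℂ) => φ (H q.1 + q.2))
        (A ×ˢ Metric.closedBall 0 δ) :=
      hφc.comp c1 fun q hq => hδV _ hq.1 _ (mem_closedBall_zero_iff.1 hq.2)
    have c3 : ContinuousOn (fun q : ℂ × (ℂ × ℂ) => g q.1) (A ×ˢ Metric.closedBall 0 δ) :=
      ContinuousOn.inv₀ (by fun_prop) fun q hq => hAne _ hq.1
    exact (c2.sub (by fun_prop)).add (continuousOn_const.mul (c3.norm.pow 2))
  have hζ₀A : ζ₀ ∈ A := ⟨hρζ.le, hζ₀.le⟩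
  obtain ⟨⟨ζ, w⟩, ⟨hζ, hw⟩, hmax⟩ := (hAc.prod (isCompact_closedBall (0 : ℂ × ℂ) δ)).exists_isMaxOn
    ⟨(ζ₀, 0), hζ₀A, Metric.mem_closedBall_self hδ.le⟩ hΨc
  simp only at hζ hw
  rw [mem_closedBall_zero_iff] at hw
  have hM : C + (η / R ^ 2 + s) ≤ Ψ (ζ, w) := by
    refine le_trans ?_ (hmax (⟨hζ₀A, Metric.mem_closedBall_self hδ.le⟩ :
      ((ζ₀, 0) : ℂ × (ℂ × ℂ)) ∈ A ×ˢ Metric.closedBall 0 δ))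
    simp only [hΨ, add_zero, Prod.fst_zero, Prod.snd_zero, norm_zero]
    rw [hsη]
    linarith
  have hηR : 0 < η / R ^ 2 := by positivity
  have hφw := hδφ ζ hζ w hw
  have huζ := hle ζ (hAR hζ)
  have hgζ := hgA ζ hζ
  simp only [hΨ] at hM
  have hNn : 0 ≤ N * (‖w.1‖ ^ 2 + ‖w.2‖ ^ 2) := by positivity
  -- The maximum of `Ψ` is at least its value at `(ζ₀, 0)`, which excludes every boundary piece:
  -- `‖w‖ = δ`, the inner circle and the outer circle.
  have hwlt : ‖w‖ < δ := by
    refine lt_of_le_of_ne hw fun h => ?_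
    have : δ ^ 2 ≤ ‖w.1‖ ^ 2 + ‖w.2‖ ^ 2 := by
      rw [← h, Prod.norm_def]
      rcases max_cases ‖w.1‖ ‖w.2‖ with h | h <;> rw [h.1] <;> nlinarith [norm_nonneg w.1, norm_nonneg w.2]
    have := mul_le_mul_of_nonneg_left this hN.le
    linarith
  have hζρ : ρ < ‖ζ - z₁‖ := by
    refine lt_of_le_of_ne hζ.1 fun h => ?_
    linarith [hρ' ζ h.ge]
  have hζR : ‖ζ - z₁‖ < R := by
    refine lt_of_le_of_ne hζ.2 fun h => ?_
    have : η * ‖g ζ‖ ^ 2 = η / R ^ 2 := by rw [hgn, h, mul_one_div]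
    linarith
  have hζne := hAne ζ hζ
  refine hφ.not_eventually_le hV (hδV ζ hζ w hw) (H := H) (g := g) (x := ζ) ?_ ?_ ?_ hN hη ?_
  · filter_upwards [hΩ.mem_nhds (hAΩ hζ)] with z hz
    exact hH.differentiableAt (hΩ.mem_nhds hz)
  · have : ∀ᶠ z in 𝓝 ζ, z - z₁ ≠ 0 :=
      (by fun_prop : ContinuousAt (fun z => z - z₁) ζ).eventually_ne hζne
    filter_upwards [this] with z hz
    exact DifferentiableAt.inv (by fun_prop) hz
  · have h := (((hasDerivAt_id ζ).sub_const z₁).inv hζne).deriv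
    have h' : deriv g ζ = -1 / (ζ - z₁) ^ 2 := h
    rw [h']
    exact div_ne_zero (by simp) (pow_ne_zero _ hζne)
  · have e1 : ∀ᶠ t in 𝓝 (0 : ℂ), ρ < ‖ζ + t - z₁‖ :=
      (by fun_prop : ContinuousAt (fun t : ℂ => ‖ζ + t - z₁‖) 0).eventually_const_lt (by simpa)
    have e2 : ∀ᶠ t in 𝓝 (0 : ℂ), ‖ζ + t - z₁‖ < R :=
      (by fun_prop : ContinuousAt (fun t : ℂ => ‖ζ + t - z₁‖) 0).eventually_lt_const (by simpa)
    have c0 : ContinuousAt (fun t : ℂ => H (ζ + t)) 0 := by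
      refine ContinuousAt.comp (g := H) (f := fun t => ζ + t) ?_ (by fun_prop)
      simpa using hcHat ζ (hAΩ hζ)
    have e3 : ∀ᶠ t in 𝓝 (0 : ℂ), ‖H ζ + w + t • deriv H ζ - H (ζ + t)‖ < δ :=
      ((by fun_prop : ContinuousAt (fun t : ℂ => H ζ + w + t • deriv H ζ) 0).sub
        c0).norm.eventually_lt_const (by simpa)
    filter_upwards [e1, e2, e3] with t h1 h2 h3
    have h := hmax (⟨⟨h1.le, h2.le⟩, mem_closedBall_zero_iff.2 h3.le⟩ :
      ((ζ + t, H ζ + w + t • deriv H ζ - H (ζ + t)) : ℂ × (ℂ × ℂ)) ∈ A ×ˢ Metric.closedBall 0 δ)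
    simp only [hΨ, Set.mem_ofPred_eq] at h
    rw [add_sub_cancel] at h
    rw [add_sub_cancel_left]
    exact h

/-- Strong maximum principle along a holomorphic curve. -/
theorem PlurisubharmonicOn.eqOn_of_isPreconnected {φ : ℂ × ℂ → ℝ} {V : Set (ℂ × ℂ)}
    (hV : IsOpen V) (hφc : ContinuousOn φ V) (hφ : PlurisubharmonicOn φ V) {H : ℂ → ℂ × ℂ}
    {Ω : Set ℂ} (hΩ : IsOpen Ω) (hH : DifferentiableOn ℂ H Ω) (hHV : Set.MapsTo H Ω V) {C : ℝ}
    (hle : ∀ z ∈ Ω, φ (H z) ≤ C) {S : Set ℂ} (hS : IsPreconnected S) (hSΩ : S ⊆ Ω) {x : ℂ}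
    (hx : x ∈ S) (hxC : φ (H x) = C) : ∀ z ∈ S, φ (H z) = C := by
  have hcu : ContinuousOn (φ ∘ H) Ω := hφc.comp hH.continuousOn hHV
  have o1 : IsOpen {z ∈ Ω | φ (H z) < C} := hcu.isOpen_inter_preimage hΩ isOpen_Iio
  have o2 : IsOpen {z ∈ Ω | φ (H z) = C} := by
    rw [Metric.isOpen_iff]
    rintro z ⟨hz, hzC⟩
    obtain ⟨r, hr, hrΩ⟩ := Metric.isOpen_iff.1 hΩ z hz
    refine ⟨r / 2, by positivity, fun y hy => ?_⟩
    have hyz : dist y z < r / 2 := hy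
    refine ⟨hrΩ (Metric.ball_subset_ball (by linarith) hy), ?_⟩
    -- If the value at `y` were below `C`, a disc centred at `y` and containing `z` would force
    -- strict inequality at `z`.
    by_contra hne
    obtain ⟨R, hR1, hR2⟩ := exists_between hyz
    have hsub : Metric.closedBall y R ⊆ Ω := fun t ht => hrΩ <| by
      have := dist_triangle t y z
      have := Metric.mem_closedBall.1 ht
      rw [Metric.mem_ball]
      linarith
    have := hφ.lt_of_center_lt hV hφc hΩ hH hHV hsub (fun t ht => hle t (hsub ht))
      (lt_of_le_of_ne (hle y (hsub (Metric.mem_closedBall_self (dist_nonneg.trans hR1.le)))) hne) z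
      (by rwa [Metric.mem_ball, dist_comm])
    exact this.ne hzC
  intro z hz
  by_contra hne
  obtain ⟨t, -, ht1, ht2⟩ := hS _ _ o2 o1
    (fun y hy => (hle y (hSΩ hy)).eq_or_lt.imp (fun h => ⟨hSΩ hy, h⟩) fun h => ⟨hSΩ hy, h⟩)
    ⟨x, hx, hSΩ hx, hxC⟩ ⟨z, hz, hSΩ hz, lt_of_le_of_ne (hle z (hSΩ hz)) hne⟩
  exact ht2.2.ne ht1.2

/-- Subtracting a multiple of the pluriharmonic function `log |z|` preserves plurisubharmonicity. -/
theorem PlurisubharmonicOn.sub_mul_log {φ : ℂ × ℂ → ℝ} {V : Set (ℂ × ℂ)}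
    (hφc : ContinuousOn φ V) (hφ : PlurisubharmonicOn φ V) (δ : ℝ) :
    ContinuousOn (fun p => φ p - δ * Real.log ‖p.1‖) (V ∩ {p | p.1 ≠ 0}) ∧
      PlurisubharmonicOn (fun p => φ p - δ * Real.log ‖p.1‖) (V ∩ {p | p.1 ≠ 0}) := by
  have hc : ContinuousOn (fun p => φ p - δ * Real.log ‖p.1‖) (V ∩ {p | p.1 ≠ 0}) := by
    refine (hφc.mono Set.inter_subset_left).sub (continuousOn_const.mul ?_)
    exact ContinuousOn.log (by fun_prop) fun p hp => norm_ne_zero_iff.2 hp.2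
  refine ⟨hc, hc.upperSemicontinuousOn, fun p v hpv => ?_⟩
  obtain ⟨hi, hle⟩ := hφ.2 p v fun t ht => (hpv t ht).1
  -- The first coordinate has no zero on the disc, so the logarithm of its modulus satisfies the
  -- mean value equality.
  have han : AnalyticOnNhd ℂ (fun t : ℂ => (p + t • v).1) (Metric.closedBall 0 |1|) := by
    have : Differentiable ℂ (fun t : ℂ => (p + t • v).1) := by fun_prop
    exact fun t _ => this.analyticAt t
  have hne : ∀ t ∈ Metric.closedBall (0 : ℂ) |1|, (p + t • v).1 ≠ 0 := fun t ht =>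
    (hpv t (by simpa using ht)).2
  have hlog := han.circleAverage_log_norm_of_ne_zero hne
  have hli : CircleIntegrable (fun t : ℂ => δ • Real.log ‖(p + t • v).1‖) 0 1 := by
    refine ContinuousOn.circleIntegrable' (ContinuousOn.fun_const_smul (ContinuousOn.log ?_ ?_) _)
    · fun_prop
    · exact fun t ht => norm_ne_zero_iff.2 (hne t (Metric.sphere_subset_closedBall ht))
  refine ⟨hi.sub hli, ?_⟩
  have := Real.circleAverage_fun_sub hi hli
  rw [Real.circleAverage_fun_smul, hlog] at this
  simp only [smul_eq_mul, add_zero, Prod.fst_add, zero_smul] at this ⊢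
  rw [this]
  simpa using hle

/-! ### The Wermer set as an image of compact families of roots. -/

/-- The pairs `(z, r)`, where `r` is a choice of a square root of `z - a k` for every `k`. -/
def rootFamilies (a : ℕ → ℂ) : Set (ℂ × (ℕ → ℂ)) :=
  {q | ∀ k, q.2 k ^ 2 = q.1 - a k}

/-- The point `(z, ∑ ε_k r_k)` that belongs to a family of roots. -/
noncomputable def rootSumPoint (ε : ℕ → ℝ) (q : ℂ × (ℕ → ℂ)) : ℂ × ℂ :=
  (q.1, ∑' k, (ε k : ℂ) * q.2 k)

theorem norm_le_of_mem_rootFamilies {a : ℕ → ℂ} {q : ℂ × (ℕ → ℂ)} (hq : q ∈ rootFamilies a) {R : ℝ}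
    (hR : ‖q.1‖ ≤ R) (k : ℕ) : ‖q.2 k‖ ≤ √R + √‖a k‖ := by
  have h : ‖q.2 k‖ ^ 2 ≤ R + ‖a k‖ := by
    rw [← norm_pow, hq k]
    exact (norm_sub_le _ _).trans (by gcongr)
  calc ‖q.2 k‖ ≤ √(R + ‖a k‖) := Real.le_sqrt_of_sq_le h
    _ ≤ √R + √‖a k‖ := by
      rw [Real.sqrt_le_left (by positivity), add_sq, Real.sq_sqrt ((norm_nonneg _).trans hR),
        Real.sq_sqrt (norm_nonneg _)]
      have : 0 ≤ 2 * √R * √‖a k‖ := by positivity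
      linarith

theorem exists_mem_rootFamilies (a : ℕ → ℂ) (z : ℂ) : ∃ r, (z, r) ∈ rootFamilies a :=
  ⟨fun k => (z - a k) ^ ((2 : ℕ) : ℂ)⁻¹, fun _ => Complex.cpow_nat_inv_pow _ two_ne_zero⟩

theorem isClosed_rootFamilies (a : ℕ → ℂ) : IsClosed (rootFamilies a) := by
  have : rootFamilies a = ⋂ k, {q | q.2 k ^ 2 = q.1 - a k} := by
    ext q
    simp [rootFamilies]
  rw [this]
  exact isClosed_iInter fun k => isClosed_eq (by fun_prop) (by fun_prop)

theorem isCompact_rootFamilies (a : ℕ → ℂ) (R : ℝ) :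
    IsCompact (rootFamilies a ∩ {q | ‖q.1‖ ≤ R}) := by
  have hc : IsCompact (Metric.closedBall (0 : ℂ) R ×ˢ
      Set.univ.pi fun k => Metric.closedBall (0 : ℂ) (√R + √‖a k‖)) :=
    (isCompact_closedBall _ _).prod (isCompact_univ_pi fun k => isCompact_closedBall _ _)
  refine hc.of_isClosed_subset ((isClosed_rootFamilies a).inter
    (isClosed_le (by fun_prop) continuous_const)) fun q hq => ⟨?_, fun k _ => ?_⟩
  · simpa using hq.2
  · simpa using norm_le_of_mem_rootFamilies hq.1 hq.2 k

section Summable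

variable {a : ℕ → ℂ} {ε : ℕ → ℝ}

theorem norm_mul_root_le (hε : ∀ k, 0 ≤ ε k) {q : ℂ × (ℕ → ℂ)} (hq : q ∈ rootFamilies a) {R : ℝ}
    (hR : ‖q.1‖ ≤ R) (k : ℕ) : ‖(ε k : ℂ) * q.2 k‖ ≤ ε k * √R + ε k * √‖a k‖ := by
  rw [norm_mul, Complex.norm_real, Real.norm_of_nonneg (hε k), ← mul_add]
  exact mul_le_mul_of_nonneg_left (norm_le_of_mem_rootFamilies hq hR k) (hε k)

variable (hε : ∀ k, 0 ≤ ε k) (hs : Summable ε) (hsa : Summable fun k => ε k * √‖a k‖)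
include hε hs hsa

theorem continuousOn_rootSumPoint (R : ℝ) :
    ContinuousOn (rootSumPoint ε) (rootFamilies a ∩ {q | ‖q.1‖ ≤ R}) :=
  continuousOn_fst.prodMk <| continuousOn_tsum (fun k => by fun_prop)
    ((hs.mul_right (√R)).add hsa) fun k _ hq => norm_mul_root_le hε hq.1 hq.2 k

/-- A finite sum differs from a full sum by a tail that vanishes uniformly over bounded $z$. A limit
of points of the finite stages is therefore a limit of full sums, and these lie in a compact image.
-/
theorem wermerSet_eq_image : wermerSet a ε = rootSumPoint ε '' rootFamilies a := by
  have hsum : ∀ R, Summable fun k => ε k * √R + ε k * √‖a k‖ := fun R =>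
    (hs.mul_right (√R)).add hsa
  ext b
  constructor
  · rintro ⟨s, hsE, hlim⟩
    have hr : ∀ n, ∃ r : ℕ → ℂ, ((s n).1, r) ∈ rootFamilies a ∧
        (s n).2 = ∑ k ∈ Finset.range n, (ε k : ℂ) * r k := by
      intro n
      obtain ⟨r, hr, hrs⟩ := hsE n
      obtain ⟨r', hr'⟩ := exists_mem_rootFamilies a (s n).1
      refine ⟨fun k => if k < n then r k else r' k, fun k => ?_, ?_⟩
      · by_cases hk : k < n
        · simpa [hk] using hr k hk
        · simpa [hk] using hr' k
      · rw [hrs]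
        exact Finset.sum_congr rfl fun k hk => by simp [Finset.mem_range.1 hk]
    choose r hrX hrs using hr
    set R := ‖b.1‖ + 1
    have hfst : Tendsto (fun n => (s n).1) atTop (𝓝 b.1) := (continuous_fst.tendsto b).comp hlim
    have hbound : ∀ᶠ n in atTop, ‖(s n).1‖ ≤ R :=
      (hfst.norm.eventually_lt_const (lt_add_one _)).mono fun n hn => hn.le
    have htail := tendsto_sum_nat_add fun k => ε k * √R + ε k * √‖a k‖
    have hdiff : Tendsto (fun n => (∑' k, (ε k : ℂ) * r n k) - (s n).2) atTop (𝓝 0) := by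
      refine squeeze_zero_norm' ?_ htail
      filter_upwards [hbound] with n hn
      have hb := norm_mul_root_le hε (hrX n) hn
      have hsn : Summable fun k => (ε k : ℂ) * r n k := Summable.of_norm_bounded (hsum R) hb
      rw [hrs n, ← hsn.sum_add_tsum_nat_add n, add_sub_cancel_left]
      exact tsum_of_norm_bounded ((summable_nat_add_iff n).2 (hsum R)).hasSum fun k => hb (k + n)
    have hpt : Tendsto (fun n => rootSumPoint ε ((s n).1, r n)) atTop (𝓝 b) := by
      have h2 : Tendsto (fun n => ((∑' k, (ε k : ℂ) * r n k) - (s n).2) + (s n).2) atTop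
          (𝓝 (0 + b.2)) := hdiff.add ((continuous_snd.tendsto b).comp hlim)
      simp only [sub_add_cancel, zero_add] at h2
      exact hfst.prodMk_nhds h2
    have hcl := ((isCompact_rootFamilies a R).image_of_continuousOn
      (continuousOn_rootSumPoint hε hs hsa R)).isClosed
    refine Set.image_mono Set.inter_subset_left (hcl.mem_of_tendsto hpt ?_)
    filter_upwards [hbound] with n hn
    exact Set.mem_image_of_mem _ ⟨hrX n, hn⟩
  · rintro ⟨⟨z, r⟩, hq, rfl⟩
    refine ⟨fun n => (z, ∑ k ∈ Finset.range n, (ε k : ℂ) * r k),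
      fun n => ⟨r, fun k _ => hq k, rfl⟩, ?_⟩
    have hsn : Summable fun k => (ε k : ℂ) * r k :=
      Summable.of_norm_bounded (hsum ‖z‖) (norm_mul_root_le hε hq le_rfl)
    exact tendsto_const_nhds.prodMk_nhds hsn.hasSum.tendsto_sum_nat

theorem isCompact_wermerSet_inter (R : ℝ) : IsCompact (wermerSet a ε ∩ {p | ‖p.1‖ ≤ R}) := by
  have : wermerSet a ε ∩ {p | ‖p.1‖ ≤ R} =
      rootSumPoint ε '' (rootFamilies a ∩ {q | ‖q.1‖ ≤ R}) := by
    rw [wermerSet_eq_image hε hs hsa]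
    ext p
    constructor
    · rintro ⟨⟨q, hq, rfl⟩, hp⟩
      exact ⟨q, ⟨hq, hp⟩, rfl⟩
    · rintro ⟨q, ⟨hq, hp⟩, rfl⟩
      exact ⟨⟨q, hq, rfl⟩, hp⟩
  rw [this]
  exact (isCompact_rootFamilies a R).image_of_continuousOn (continuousOn_rootSumPoint hε hs hsa R)

end Summable

/-! ### Holomorphic leaves, branched over $c$. -/

section Leaf

/-- The family of roots of `c + ζ ^ 2 - a j` that continues the family `s` of roots of `β - a j`.
The root for `a j = c` is `ζ`. -/
noncomputable def leafRoots (a : ℕ → ℂ) (c β : ℂ) (s : ℕ → ℂ) (ζ : ℂ) (j : ℕ) : ℂ :=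
  open Classical in
  if a j = c then ζ else s j * ((c + ζ ^ 2 - a j) / (β - a j)) ^ ((2 : ℕ) : ℂ)⁻¹

/-- A domain on which `leafRoots` is holomorphic. -/
def leafDomain (a : ℕ → ℂ) (c β : ℂ) : Set ℂ :=
  {ζ | ∀ j, a j ≠ c → (c + ζ ^ 2 - a j) / (β - a j) ∈ Complex.slitPlane}

/-- The holomorphic curve in the Wermer type set that is parametrised by `leafRoots`. -/
noncomputable def leafCurve (a : ℕ → ℂ) (ε : ℕ → ℝ) (c β : ℂ) (s : ℕ → ℂ) (ζ : ℂ) : ℂ × ℂ :=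
  rootSumPoint ε (c + ζ ^ 2, leafRoots a c β s ζ)

variable {a : ℕ → ℂ} {c β : ℂ} {s : ℕ → ℂ}

theorem leafRoots_mem (hs : (β, s) ∈ rootFamilies a) {ζ : ℂ} (hζ : ζ ∈ leafDomain a c β) :
    (c + ζ ^ 2, leafRoots a c β s ζ) ∈ rootFamilies a := by
  intro j
  by_cases hj : a j = c
  · simp [leafRoots, hj]
  -- If $\beta=a_j\ne c$, the quotient is $0$ by convention and lies outside the slit plane, so the
  -- domain would be empty.
  · have h0 : β - a j ≠ 0 := by
      intro h
      have := hζ j hj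
      simp [h] at this
    have hsj : s j ^ 2 = β - a j := hs j
    simp only [leafRoots, hj, if_false, mul_pow]
    rw [Complex.cpow_nat_inv_pow _ two_ne_zero, hsj, mul_div_cancel₀ _ h0]

theorem differentiableOn_leafRoots (j : ℕ) :
    DifferentiableOn ℂ (fun ζ => leafRoots a c β s ζ j) (leafDomain a c β) := by
  by_cases hj : a j = c
  · simp only [leafRoots, hj, if_true]
    exact differentiableOn_id
  · simp only [leafRoots, hj, if_false]
    refine DifferentiableOn.const_mul (DifferentiableOn.cpow (by fun_prop) (by fun_prop) ?_) _
    exact fun ζ hζ => hζ j hj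

/-- Only finitely many conditions matter locally: for distant $a_j$ the quotient stays within
distance $1$ of $1$. -/
theorem isOpen_leafDomain (hfin : ∀ R, {j | ‖β - a j‖ ≤ R}.Finite) : IsOpen (leafDomain a c β) := by
  rw [isOpen_iff_mem_nhds]
  intro ζ₀ hζ₀
  set R := ‖c‖ + (‖ζ₀‖ + 1) ^ 2 + ‖β‖
  have h1 : ∀ᶠ ζ in 𝓝 ζ₀, ∀ j ∈ {j | ‖β - a j‖ ≤ R},
      a j ≠ c → (c + ζ ^ 2 - a j) / (β - a j) ∈ Complex.slitPlane := by
    refine (eventually_all_finite (hfin R)).2 fun j _ => ?_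
    by_cases hj : a j = c
    · simp [hj]
    · have hcont : ContinuousAt (fun ζ => (c + ζ ^ 2 - a j) / (β - a j)) ζ₀ := by fun_prop
      filter_upwards [hcont.eventually_mem (Complex.isOpen_slitPlane.mem_nhds (hζ₀ j hj))]
        with ζ hζ _ using hζ
  have h2 : ∀ᶠ ζ in 𝓝 ζ₀, ‖ζ‖ < ‖ζ₀‖ + 1 :=
    continuous_norm.continuousAt.eventually_lt_const (lt_add_one _)
  filter_upwards [h1, h2] with ζ h1 h2 j hj
  by_cases hjR : ‖β - a j‖ ≤ R
  · exact h1 j hjR hj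
  · rw [not_le] at hjR
    have hR0 : 0 ≤ R := by positivity
    have h0 : β - a j ≠ 0 := norm_pos_iff.1 (hR0.trans_lt hjR)
    have : (c + ζ ^ 2 - a j) / (β - a j) = 1 + (c + ζ ^ 2 - β) / (β - a j) := by
      field_simp
      ring
    rw [this]
    refine Complex.mem_slitPlane_of_norm_lt_one ?_
    rw [norm_div, div_lt_one (norm_pos_iff.2 h0)]
    refine lt_of_le_of_lt ?_ hjR
    refine (norm_sub_le _ _).trans (add_le_add_left ((norm_add_le _ _).trans ?_) _)
    rw [norm_pow]
    gcongr

theorem differentiableOn_leafCurve {ε : ℕ → ℝ} (hε : ∀ k, 0 ≤ ε k) (hsum : Summable ε)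
    (hsa : Summable fun k => ε k * √‖a k‖) (hfin : ∀ R, {j | ‖β - a j‖ ≤ R}.Finite)
    (hs : (β, s) ∈ rootFamilies a) :
    DifferentiableOn ℂ (leafCurve a ε c β s) (leafDomain a c β) := by
  intro ζ₀ hζ₀
  set U := leafDomain a c β ∩ Metric.ball ζ₀ 1
  have hU : IsOpen U := (isOpen_leafDomain hfin).inter Metric.isOpen_ball
  have hζ₀U : ζ₀ ∈ U := ⟨hζ₀, Metric.mem_ball_self one_pos⟩
  set R := ‖c‖ + (‖ζ₀‖ + 1) ^ 2
  have hd : DifferentiableOn ℂ (fun ζ => ∑' k, (ε k : ℂ) * leafRoots a c β s ζ k) U := by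
    refine Complex.differentiableOn_tsum_of_summable_norm ((hsum.mul_right (√R)).add hsa)
      (fun k => ((differentiableOn_leafRoots k).mono Set.inter_subset_left).const_mul _) hU ?_
    intro k ζ hζ
    refine norm_mul_root_le hε (leafRoots_mem hs hζ.1) ?_ k
    have h2 : ‖ζ‖ ≤ ‖ζ₀‖ + 1 := by
      have := norm_sub_norm_le ζ ζ₀
      have := mem_ball_iff_norm.1 hζ.2
      linarith
    refine (norm_add_le _ _).trans ?_
    rw [norm_pow]
    exact add_le_add_right (by gcongr) _
  have hd1 : DifferentiableAt ℂ (fun ζ : ℂ => c + ζ ^ 2) ζ₀ := by fun_prop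
  exact (hd1.prodMk (hd.differentiableAt (hU.mem_nhds hζ₀U))).differentiableWithinAt

/-- With $\beta=c$ the leaf passes through the given point at $\zeta=0$. This treats lattice and
non-lattice centres alike; at the latter $\zeta^2$ merely covers a disc twice. -/
theorem leafRoots_self_zero (hs : (c, s) ∈ rootFamilies a) : leafRoots a c c s 0 = s := by
  funext j
  have hsj : s j ^ 2 = c - a j := hs j
  by_cases hj : a j = c
  · rw [hj, sub_self] at hsj
    simp [leafRoots, hj, pow_eq_zero_iff two_ne_zero |>.1 hsj]
  · have h0 : c - a j ≠ 0 := sub_ne_zero.2 (Ne.symm hj)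
    simp [leafRoots, hj, h0]

theorem zero_mem_leafDomain_self : (0 : ℂ) ∈ leafDomain a c c := by
  intro j hj
  have h0 : c - a j ≠ 0 := sub_ne_zero.2 (Ne.symm hj)
  simp [h0]

theorem ball_subset_leafDomain_self (h : ∀ j, a j ≠ c → 1 ≤ ‖c - a j‖) :
    Metric.ball 0 1 ⊆ leafDomain a c c := by
  intro ζ hζ j hj
  have h0 : c - a j ≠ 0 := sub_ne_zero.2 (Ne.symm hj)
  have : (c + ζ ^ 2 - a j) / (c - a j) = 1 + ζ ^ 2 / (c - a j) := by
    field_simp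
    ring
  rw [this]
  refine Complex.mem_slitPlane_of_norm_lt_one ?_
  rw [norm_div, div_lt_one (norm_pos_iff.2 h0), norm_pow]
  rw [mem_ball_zero_iff] at hζ
  exact (pow_lt_one₀ (norm_nonneg _) hζ two_ne_zero).trans_le (h j hj)

end Leaf

/-! ### Geometry of the lattice. -/

section Lattice

variable {a : ℕ → ℂ} (ha : IsLatticeEnumeration a)
include ha

theorem IsLatticeEnumeration.one_le_norm_sub {j k : ℕ} (hjk : a j ≠ a k) : 1 ≤ ‖a j - a k‖ := by
  obtain ⟨m, n, h₁⟩ : a j ∈ {z : ℂ | ∃ m n : ℤ, z = (m : ℂ) + (n : ℂ) * Complex.I} :=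
    ha.2 ▸ Set.mem_range_self j
  obtain ⟨m', n', h₂⟩ : a k ∈ {z : ℂ | ∃ m n : ℤ, z = (m : ℂ) + (n : ℂ) * Complex.I} :=
    ha.2 ▸ Set.mem_range_self k
  have hre : (a j - a k).re = ((m - m' : ℤ) : ℝ) := by simp [h₁, h₂]
  have him : (a j - a k).im = ((n - n' : ℤ) : ℝ) := by simp [h₁, h₂]
  by_cases h : m - m' = 0
  · have hn : n - n' ≠ 0 := by
      intro h'
      refine hjk (sub_eq_zero.1 (Complex.ext ?_ ?_))
      · simp [hre, h]
      · simp [him, h']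
    refine le_trans ?_ (Complex.abs_im_le_norm _)
    rw [him]
    exact_mod_cast Int.one_le_abs hn
  · refine le_trans ?_ (Complex.abs_re_le_norm _)
    rw [hre]
    exact_mod_cast Int.one_le_abs h

theorem IsLatticeEnumeration.finite_norm_sub_le (c : ℂ) (R : ℝ) : {j | ‖c - a j‖ ≤ R}.Finite := by
  obtain ⟨N, hN⟩ := exists_nat_ge (‖c‖ + R)
  have hfin : ((fun p : ℤ × ℤ => (p.1 : ℂ) + (p.2 : ℂ) * Complex.I) ''
      (Set.Icc (-N : ℤ) N ×ˢ Set.Icc (-N : ℤ) N)).Finite :=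
    ((Set.finite_Icc _ _).prod (Set.finite_Icc _ _)).image _
  refine (hfin.preimage ha.1.injOn).subset fun j hj => ?_
  obtain ⟨m, n, h⟩ : a j ∈ {z : ℂ | ∃ m n : ℤ, z = (m : ℂ) + (n : ℂ) * Complex.I} :=
    ha.2 ▸ Set.mem_range_self j
  have hnorm : ‖a j‖ ≤ N := by
    have h1 : ‖c - a j‖ ≤ R := hj
    have h2 := norm_sub_norm_le (a j) c
    rw [norm_sub_rev] at h2
    linarith
  have hm : |((m : ℤ) : ℝ)| ≤ N := by
    have := (Complex.abs_re_le_norm (a j)).trans hnorm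
    simpa [h] using this
  have hn : |((n : ℤ) : ℝ)| ≤ N := by
    have := (Complex.abs_im_le_norm (a j)).trans hnorm
    simpa [h] using this
  refine ⟨(m, n), ⟨?_, ?_⟩, h.symm⟩
  · exact abs_le.1 (by exact_mod_cast hm)
  · exact abs_le.1 (by exact_mod_cast hn)

theorem IsLatticeEnumeration.exists_norm_sub_lt_one (z : ℂ) : ∃ k, ‖z - a k‖ < 1 := by
  obtain ⟨k, hk⟩ : (round z.re : ℂ) + (round z.im : ℂ) * Complex.I ∈ Set.range a :=
    ha.2 ▸ ⟨_, _, rfl⟩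
  refine ⟨k, ?_⟩
  have h1 := abs_le.1 (abs_sub_round z.re)
  have h2 := abs_le.1 (abs_sub_round z.im)
  have : ‖z - a k‖ ^ 2 < 1 ^ 2 := by
    rw [← Complex.normSq_eq_norm_sq, Complex.normSq_apply, hk]
    simp only [Complex.sub_re, Complex.add_re, Complex.intCast_re, Complex.mul_re, Complex.I_re,
      mul_zero, Complex.intCast_im, Complex.I_im, mul_one, sub_self, add_zero, Complex.sub_im,
      Complex.add_im, Complex.mul_im, zero_add]
    nlinarith
  exact lt_of_pow_lt_pow_left₀ 2 zero_le_one this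

/-- Nonzero lattice points have modulus at least $1$, so only the index of the origin needs a
separate bound. -/
theorem IsLatticeEnumeration.summable {ε : ℕ → ℝ} (hε : ∀ k, 0 ≤ ε k)
    (hsa : Summable fun k => ε k * √‖a k‖) : Summable ε := by
  obtain ⟨k₀, hk₀⟩ : (0 : ℂ) ∈ Set.range a := ha.2 ▸ ⟨0, 0, by simp⟩
  refine (hsa.add (summable_of_ne_finset_zero (s := {k₀})
    (f := fun k => if k = k₀ then ε k else 0) fun k hk => ?_)).of_nonneg_of_le hε fun k => ?_
  · simp [Finset.mem_singleton.not.1 hk]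
  · by_cases hk : k = k₀
    · simp [hk, hk₀]
    · have h := ha.one_le_norm_sub (fun h => hk (ha.1 h) : a k ≠ a k₀)
      rw [hk₀, sub_zero] at h
      simp only [hk, if_false, add_zero]
      exact le_mul_of_one_le_right (hε k) (Real.one_le_sqrt.2 h)

end Lattice

/-! ### Generic base points and sign changes of a single root. -/

/-- The point `b` is on no line through two of the points `a k`. -/
def IsOffLatticeLines (a : ℕ → ℂ) (b : ℂ) : Prop :=
  ∀ j k, j ≠ k → ((a k - a j) * (starRingEnd ℂ) (b - a j)).im ≠ 0

/-- Baire's theorem: the complement of each of the countably many lines is open and dense. -/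
theorem dense_isOffLatticeLines {a : ℕ → ℂ} (ha : Function.Injective a) :
    Dense {b | IsOffLatticeLines a b} := by
  have : {b | IsOffLatticeLines a b} = ⋂ p : {p : ℕ × ℕ // p.1 ≠ p.2},
      {b | ((a p.1.2 - a p.1.1) * (starRingEnd ℂ) (b - a p.1.1)).im ≠ 0} := by
    ext b
    simp [IsOffLatticeLines]
  rw [this]
  refine dense_iInter_of_isOpen (fun p => ?_) ?_
  · exact isOpen_ne_fun (by fun_prop) continuous_const
  · rintro ⟨⟨j, k⟩, hjk⟩
    rw [Metric.dense_iff]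
    intro b r hr
    have hd : a k - a j ≠ 0 := sub_ne_zero.2 fun h => hjk (ha h).symm
    set d := a k - a j
    have hd' : 0 < ‖d‖ := norm_pos_iff.2 hd
    by_cases hb : (d * (starRingEnd ℂ) (b - a j)).im = 0
    · set t : ℝ := r / (2 * ‖d‖)
      have ht : 0 < t := by positivity
      -- A push perpendicular to the line leaves it.
      refine ⟨b + t * (Complex.I * d), ?_, ?_⟩
      · have : t * ‖d‖ = r / 2 := by simp only [t]; field_simp
        simp only [mem_ball_iff_norm, add_sub_cancel_left, norm_mul, Complex.norm_real,
          Real.norm_of_nonneg ht.le, Complex.norm_I, one_mul, this]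
        linarith
      · have h1 : (d * (starRingEnd ℂ) (b + t * (Complex.I * d) - a j)).im =
            (d * (starRingEnd ℂ) (b - a j)).im - t * (d.re ^ 2 + d.im ^ 2) := by
          simp
          ring
        have h2 : d.re ^ 2 + d.im ^ 2 = ‖d‖ ^ 2 := by
          rw [← Complex.normSq_eq_norm_sq, Complex.normSq_apply]
          ring
        change _ ≠ _
        rw [h1, hb, h2]
        have : 0 < t * ‖d‖ ^ 2 := by positivity
        linarith
    · exact ⟨b, Metric.mem_ball_self hr, hb⟩

section Flip

variable {a : ℕ → ℂ} {b : ℂ} {r : ℕ → ℂ}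

theorem IsOffLatticeLines.ne (hb : IsOffLatticeLines a b) (j : ℕ) : b - a j ≠ 0 := by
  intro h
  have := hb j (j + 1) (by simp)
  simp [h] at this

theorem IsOffLatticeLines.mul_mem_leafDomain (hb : IsOffLatticeLines a b) (hr : (b, r) ∈ rootFamilies a)
    (k : ℕ) {τ : ℝ} (hτ : |τ| ≤ 1) : (τ : ℂ) * r k ∈ leafDomain a (a k) b := by
  intro j hj
  have hrk : r k ^ 2 = b - a k := hr k
  have hjk : j ≠ k := fun h => hj (h ▸ rfl)
  have h0 := hb.ne j
  -- The quotient runs along the segment from $(a_k-a_j)/(b-a_j)$, which is not real, to $1$, and so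
  -- avoids the cut.
  have h1 : (a k + ((τ : ℂ) * r k) ^ 2 - a j) / (b - a j) =
      (τ ^ 2 : ℝ) + (1 - τ ^ 2 : ℝ) * ((a k - a j) / (b - a j)) := by
    rw [mul_pow, hrk]
    field_simp
    push_cast
    ring
  rw [h1]
  rcases hτ.eq_or_lt with h | h
  · have : τ ^ 2 = 1 := by rw [← sq_abs, h, one_pow]
    simp [this]
  · have hτ2 : 0 < 1 - τ ^ 2 := by
      rw [← sq_abs]
      nlinarith [abs_nonneg τ]
    refine Complex.mem_slitPlane_iff.2 (Or.inr ?_)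
    have him : ((a k - a j) / (b - a j)).im ≠ 0 := by
      rw [div_eq_mul_inv, Complex.inv_def, ← mul_assoc, Complex.im_mul_ofReal]
      exact mul_ne_zero (hb j k hjk) (inv_ne_zero (Complex.normSq_pos.2 h0).ne')
    rw [Complex.add_im, Complex.ofReal_im, zero_add, Complex.im_ofReal_mul]
    exact mul_ne_zero hτ2.ne' him

theorem IsOffLatticeLines.leafRoots_root (ha : Function.Injective a) (hb : IsOffLatticeLines a b)
    (hr : (b, r) ∈ rootFamilies a) (k : ℕ) : leafRoots a (a k) b r (r k) = r := by
  have hrk : r k ^ 2 = b - a k := hr k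
  funext j
  by_cases hj : a j = a k
  · simp [leafRoots, ha hj]
  · have h0 := hb.ne j
    simp [leafRoots, hj, hrk, h0]

theorem IsOffLatticeLines.leafRoots_neg_root (ha : Function.Injective a) (hb : IsOffLatticeLines a b)
    (hr : (b, r) ∈ rootFamilies a) (k : ℕ) :
    leafRoots a (a k) b r (-r k) = Function.update r k (-r k) := by
  have hrk : r k ^ 2 = b - a k := hr k
  funext j
  by_cases hj : j = k
  · subst hj
    simp [leafRoots]
  · have h0 := hb.ne j
    simp [leafRoots, hj, ha.ne hj, hrk, h0]

end Flip

/-! ### Attaining the maximum and propagating it. -/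

section Liouville

variable {a : ℕ → ℂ} {ε : ℕ → ℝ} (ha : IsLatticeEnumeration a) (hε : ∀ k, 0 ≤ ε k)
  (hsa : Summable fun k => ε k * √‖a k‖)
include ha hε hsa

theorem rootSumPoint_mem_wermerSet {q : ℂ × (ℕ → ℂ)} (hq : q ∈ rootFamilies a) :
    rootSumPoint ε q ∈ wermerSet a ε := by
  rw [wermerSet_eq_image hε (ha.summable hε hsa) hsa]
  exact Set.mem_image_of_mem _ hq

variable {V : Set (ℂ × ℂ)} (hV : IsOpen V) (hEV : wermerSet a ε ⊆ V) {φ : ℂ × ℂ → ℝ}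
  (hφc : ContinuousOn φ V) (hφ : PlurisubharmonicOn φ V)
include hV hEV hφc hφ

theorem exists_isMaxOn_wermerSet (hbdd : BddAbove (φ '' V)) :
    ∃ p ∈ wermerSet a ε, ∀ q ∈ wermerSet a ε, φ q ≤ φ p := by
  have hs := ha.summable hε hsa
  have hφE : ContinuousOn φ (wermerSet a ε) := hφc.mono hEV
  obtain ⟨r₀, hr₀⟩ := exists_mem_rootFamilies a 0
  obtain ⟨p, hp, hmax⟩ := (isCompact_wermerSet_inter hε hs hsa 1).exists_isMaxOn
    ⟨_, rootSumPoint_mem_wermerSet ha hε hsa hr₀, by simp [rootSumPoint]⟩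
    (hφE.mono Set.inter_subset_left)
  refine ⟨p, hp.1, ?_⟩
  by_contra! hcon
  obtain ⟨p₁, hp₁, hlt⟩ := hcon
  have hp₁n : 1 < ‖p₁.1‖ := by
    by_contra! h
    exact hlt.not_ge (hmax ⟨hp₁, h⟩)
  have hlog₁ := Real.log_pos hp₁n
  obtain ⟨δ, hδ, hδ'⟩ : ∃ δ > 0, φ p < φ p₁ - δ * Real.log ‖p₁.1‖ := by
    refine ⟨(φ p₁ - φ p) / (2 * Real.log ‖p₁.1‖), div_pos (by linarith) (by linarith), ?_⟩
    have : (φ p₁ - φ p) / (2 * Real.log ‖p₁.1‖) * Real.log ‖p₁.1‖ = (φ p₁ - φ p) / 2 := by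
      field_simp
    linarith
  obtain ⟨B, hB⟩ := hbdd
  obtain ⟨R, hR₁, hR₂⟩ : ∃ R, ‖p₁.1‖ ≤ R ∧ B - δ * Real.log R ≤ φ p := by
    refine ⟨max ‖p₁.1‖ (Real.exp ((B - φ p) / δ)), le_max_left _ _, ?_⟩
    have h := Real.log_le_log (Real.exp_pos _) (le_max_right ‖p₁.1‖ (Real.exp ((B - φ p) / δ)))
    rw [Real.log_exp, div_le_iff₀ hδ] at h
    linarith
  set ψ : ℂ × ℂ → ℝ := fun p => φ p - δ * Real.log ‖p.1‖ with hψ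
  obtain ⟨hψc, hψpsh⟩ := hφ.sub_mul_log hφc δ
  have hV' : IsOpen (V ∩ {p | p.1 ≠ 0}) :=
    hV.inter (isOpen_ne_fun continuous_fst continuous_const)
  set K : Set (ℂ × ℂ) := wermerSet a ε ∩ {p | ‖p.1‖ ≤ R} ∩ {p | 1 ≤ ‖p.1‖} with hK
  have hKc : IsCompact K := (isCompact_wermerSet_inter hε hs hsa R).inter_right
    (isClosed_le continuous_const (by fun_prop))
  have hne_zero : ∀ z : ℂ, 1 ≤ ‖z‖ → z ≠ 0 := fun z hz =>
    norm_pos_iff.1 (one_pos.trans_le hz)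
  have hKV' : K ⊆ V ∩ {p | p.1 ≠ 0} := fun q hq => ⟨hEV hq.1.1, hne_zero _ hq.2⟩
  obtain ⟨q₀, hq₀, hq₀max⟩ := hKc.exists_isMaxOn ⟨p₁, ⟨hp₁, hR₁⟩, hp₁n.le⟩ (hψc.mono hKV')
  have hK₂ : IsCompact (K ∩ ψ ⁻¹' {ψ q₀}) := hKc.of_isClosed_subset
    ((hψc.mono hKV').preimage_isClosed_of_isClosed hKc.isClosed isClosed_singleton)
    Set.inter_subset_left
  -- Among the maximum points of `ψ`, one with largest $|z|$ is taken; the leaf through it will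
  -- contain another one further out.
  obtain ⟨q, ⟨hqK, hqψ⟩, hqmax⟩ := hK₂.exists_isMaxOn ⟨q₀, hq₀, rfl⟩
    (f := fun p => ‖p.1‖) (by fun_prop)
  replace hqψ : ψ q = ψ q₀ := hqψ
  have hψp : φ p < ψ q₀ := hδ'.trans_le (hq₀max ⟨⟨hp₁, hR₁⟩, hp₁n.le⟩)
  have hq1 : 1 < ‖q.1‖ := by
    refine lt_of_le_of_ne hqK.2 fun h => ?_
    have h1 : φ q ≤ φ p := hmax ⟨hqK.1.1, h.ge⟩
    have h2 : ψ q = φ q := by simp [hψ, ← h]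
    linarith
  have hqR : ‖q.1‖ < R := by
    refine lt_of_le_of_ne hqK.1.2 fun h => ?_
    have h1 : φ q ≤ B := hB (Set.mem_image_of_mem φ (hEV hqK.1.1))
    have h2 : ψ q = φ q - δ * Real.log R := by simp [hψ, h]
    linarith
  obtain ⟨⟨z, r⟩, hzr, rfl⟩ : q ∈ rootSumPoint ε '' rootFamilies a :=
    wermerSet_eq_image hε hs hsa ▸ hqK.1.1
  replace hq1 : 1 < ‖z‖ := hq1
  replace hqR : ‖z‖ < R := hqR
  set Ω : Set ℂ := leafDomain a z z ∩ {ζ | 1 < ‖z + ζ ^ 2‖ ∧ ‖z + ζ ^ 2‖ < R} with hΩdef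
  have hcn : Continuous fun ζ : ℂ => ‖z + ζ ^ 2‖ := by fun_prop
  have hΩ : IsOpen Ω := (isOpen_leafDomain (ha.finite_norm_sub_le z)).inter
    ((isOpen_lt continuous_const hcn).inter (isOpen_lt hcn continuous_const))
  have h0Ω : (0 : ℂ) ∈ Ω := ⟨zero_mem_leafDomain_self, by simpa using hq1, by simpa using hqR⟩
  obtain ⟨ρ, hρ, hρΩ⟩ := Metric.isOpen_iff.1 hΩ 0 h0Ω
  have hΩK : Set.MapsTo (leafCurve a ε z z r) Ω K := fun ζ hζ =>
    ⟨⟨rootSumPoint_mem_wermerSet ha hε hsa (leafRoots_mem hzr hζ.1), hζ.2.2.le⟩, hζ.2.1.le⟩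
  have hconst := hψpsh.eqOn_of_isPreconnected hV' hψc hΩ
    ((differentiableOn_leafCurve hε hs hsa (ha.finite_norm_sub_le z) hzr).mono
      Set.inter_subset_left) (hΩK.mono_right hKV') (C := ψ q₀) (fun ζ hζ => hq₀max (hΩK hζ))
    (convex_ball (0 : ℂ) ρ).isPreconnected hρΩ (Metric.mem_ball_self hρ) (by
      rw [← hqψ]
      simp [leafCurve, leafRoots_self_zero hzr, hψ])
  -- With $w^2=z$ the parameter $\zeta=\tau w$ gives base point $(1+\tau^2)z$, of larger modulus.
  obtain ⟨w, hw⟩ := IsAlgClosed.exists_pow_nat_eq z two_pos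
  set τ : ℝ := ρ / (2 * (‖w‖ + 1)) with hτ
  have hτ0 : 0 < τ := by positivity
  have hτw : (τ : ℂ) * w ∈ Metric.ball (0 : ℂ) ρ := by
    rw [mem_ball_zero_iff, norm_mul, Complex.norm_real, Real.norm_of_nonneg hτ0.le, hτ,
      div_mul_eq_mul_div, div_lt_iff₀ (by positivity)]
    nlinarith [norm_nonneg w]
  have hle : ‖z + (τ * w) ^ 2‖ ≤ ‖z‖ := hqmax (⟨hΩK (hρΩ hτw), hconst _ hτw⟩ :
    leafCurve a ε z z r (τ * w) ∈ K ∩ ψ ⁻¹' {ψ q₀})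
  have heq : z + (τ * w) ^ 2 = ((1 + τ ^ 2 : ℝ) : ℂ) * z := by
    rw [mul_pow, hw]
    push_cast
    ring
  rw [heq, norm_mul, Complex.norm_real, Real.norm_of_nonneg (by positivity)] at hle
  nlinarith [mul_pos (pow_pos hτ0 2) (one_pos.trans hq1)]

variable {C : ℝ} (hC : ∀ p ∈ wermerSet a ε, φ p ≤ C)
include hC

theorem eq_on_leaf {c β : ℂ} {s : ℕ → ℂ} (hs : (β, s) ∈ rootFamilies a) {S : Set ℂ}
    (hS : IsPreconnected S) (hSD : S ⊆ leafDomain a c β) {x : ℂ} (hx : x ∈ S)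
    (hxC : φ (leafCurve a ε c β s x) = C) : ∀ ζ ∈ S, φ (leafCurve a ε c β s ζ) = C := by
  have hE : Set.MapsTo (leafCurve a ε c β s) (leafDomain a c β) (wermerSet a ε) := fun ζ hζ =>
    rootSumPoint_mem_wermerSet ha hε hsa (leafRoots_mem hs hζ)
  exact hφ.eqOn_of_isPreconnected hV hφc (isOpen_leafDomain (ha.finite_norm_sub_le β))
    (differentiableOn_leafCurve hε (ha.summable hε hsa) hsa (ha.finite_norm_sub_le β) hs)
    (hE.mono_right hEV) (fun ζ hζ => hC _ (hE hζ)) hS hSD hx hxC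

/-- The base point $a_k+\tau^2(b-a_k)$ moves from $b$ at $\tau=1$ to the branch point at $\tau=0$
and returns on the other sheet at $\tau=-1$. -/
theorem eq_on_branch_leaf {b : ℂ} (hb : IsOffLatticeLines a b) {r : ℕ → ℂ}
    (hr : (b, r) ∈ rootFamilies a) (hrC : φ (rootSumPoint ε (b, r)) = C) (k : ℕ) {τ : ℝ}
    (hτ : |τ| ≤ 1) : φ (leafCurve a ε (a k) b r (τ * r k)) = C := by
  have hrk : r k ^ 2 = b - a k := hr k
  refine eq_on_leaf ha hε hsa hV hEV hφc hφ hC hr (x := r k)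
    (S := (fun τ : ℝ => (τ : ℂ) * r k) '' Set.Icc (-1) 1)
    (isPreconnected_Icc.image _ (by fun_prop)) ?_ ⟨1, by simp⟩ ?_ _ ⟨τ, abs_le.1 hτ, rfl⟩
  · rintro _ ⟨t, ht, rfl⟩
    exact hb.mul_mem_leafDomain hr k (abs_le.2 ht)
  · rw [leafCurve, hb.leafRoots_root ha.1 hr, hrk, add_sub_cancel]
    exact hrC

theorem eq_of_flip {b : ℂ} (hb : IsOffLatticeLines a b) {r : ℕ → ℂ}
    (hr : (b, r) ∈ rootFamilies a) (hrC : φ (rootSumPoint ε (b, r)) = C) (k : ℕ) :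
    φ (rootSumPoint ε (b, Function.update r k (-r k))) = C := by
  have hrk : r k ^ 2 = b - a k := hr k
  have h := eq_on_branch_leaf ha hε hsa hV hEV hφc hφ hC hb hr hrC k (τ := -1) (by simp)
  simpa [leafCurve, hb.leafRoots_neg_root ha.1 hr, hrk] using h

theorem exists_eq_over_lattice_point {b : ℂ} (hb : IsOffLatticeLines a b) {r : ℕ → ℂ}
    (hr : (b, r) ∈ rootFamilies a) (hrC : φ (rootSumPoint ε (b, r)) = C) (k : ℕ) :
    ∃ s, (a k, s) ∈ rootFamilies a ∧ φ (rootSumPoint ε (a k, s)) = C := by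
  have h := eq_on_branch_leaf ha hε hsa hV hEV hφc hφ hC hb hr hrC k (τ := 0) (by simp)
  have hm := leafRoots_mem hr (hb.mul_mem_leafDomain hr k (τ := 0) (by simp))
  refine ⟨leafRoots a (a k) b r 0, ?_, ?_⟩
  · simpa using hm
  · simpa [leafCurve] using h

theorem eq_on_fiber {b : ℂ} (hb : IsOffLatticeLines a b) {r : ℕ → ℂ}
    (hr : (b, r) ∈ rootFamilies a) (hrC : φ (rootSumPoint ε (b, r)) = C) {r' : ℕ → ℂ}
    (hr' : (b, r') ∈ rootFamilies a) : φ (rootSumPoint ε (b, r')) = C := by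
  -- The roots are exchanged one index at a time; the families converge coordinatewise to `r'`, and
  -- continuity carries the value to the limit.
  set u : ℕ → ℕ → ℂ := fun n j => if j < n then r' j else r j with hu
  have huX : ∀ n, (b, u n) ∈ rootFamilies a := by
    intro n j
    by_cases hj : j < n
    · simpa [hu, hj] using hr' j
    · simpa [hu, hj] using hr j
  have huC : ∀ n, φ (rootSumPoint ε (b, u n)) = C := by
    intro n
    induction n with
    | zero => simpa [hu] using hrC
    | succ n ih =>
      have hsq : r' n ^ 2 = r n ^ 2 := (hr' n).trans (hr n).symm
      have hun : u n n = r n := by simp [hu]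
      have hupd : u (n + 1) = Function.update (u n) n (r' n) := by
        funext j
        rcases lt_trichotomy j n with h | rfl | h
        · simp [hu, h, h.ne, h.trans (Nat.lt_succ_self n)]
        · simp [hu]
        · simp [hu, h.ne', h.not_gt, (Nat.succ_le_of_lt h).not_gt]
      rw [hupd]
      rcases sq_eq_sq_iff_eq_or_eq_neg.1 hsq with h | h
      · rwa [h, ← hun, Function.update_eq_self]
      · rw [h, ← hun]
        exact eq_of_flip ha hε hsa hV hEV hφc hφ hC hb (huX n) ih n
  have hlim : Tendsto (fun n => (b, u n)) atTop (𝓝 (b, r')) := by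
    refine tendsto_const_nhds.prodMk_nhds (tendsto_pi_nhds.2 fun j => ?_)
    refine tendsto_const_nhds.congr' ?_
    filter_upwards [eventually_gt_atTop j] with n hn
    simp [hu, hn]
  have hcont := continuousOn_rootSumPoint hε (ha.summable hε hsa) hsa ‖b‖ (b, r') ⟨hr', le_refl ‖b‖⟩
  have hlim' := hcont.tendsto.comp
    (tendsto_nhdsWithin_iff.2 ⟨hlim, Eventually.of_forall fun n => ⟨huX n, le_refl ‖b‖⟩⟩)
  have hφat := hφc.continuousAt
    (hV.mem_nhds (hEV (rootSumPoint_mem_wermerSet ha hε hsa hr')))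
  refine tendsto_nhds_unique (hφat.tendsto.comp hlim') ?_
  simp only [Function.comp_def, huC]
  exact tendsto_const_nhds

theorem exists_eq_of_ball_subset_leafDomain {z b : ℂ} {r : ℕ → ℂ} (hr : (z, r) ∈ rootFamilies a)
    (hrC : φ (rootSumPoint ε (z, r)) = C) {ρ : ℝ} (hρ : 0 < ρ)
    (hρD : Metric.ball 0 ρ ⊆ leafDomain a z z) (hb : ‖b - z‖ < ρ ^ 2) :
    ∃ s, (b, s) ∈ rootFamilies a ∧ φ (rootSumPoint ε (b, s)) = C := by
  obtain ⟨ζ, hζ⟩ := IsAlgClosed.exists_pow_nat_eq (b - z) two_pos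
  have hζρ : ζ ∈ Metric.ball (0 : ℂ) ρ := by
    rw [mem_ball_zero_iff]
    rw [← hζ, norm_pow] at hb
    exact lt_of_pow_lt_pow_left₀ 2 hρ.le hb
  have h := eq_on_leaf ha hε hsa hV hEV hφc hφ hC hr (convex_ball (0 : ℂ) ρ).isPreconnected hρD
    (Metric.mem_ball_self hρ) (by simpa [leafCurve, leafRoots_self_zero hr] using hrC) ζ hζρ
  have hm := leafRoots_mem hr (hρD hζρ)
  rw [leafCurve] at h
  rw [hζ, add_sub_cancel] at h hm
  exact ⟨_, hm, h⟩

/-- The leaf centred at $(z,r)$ meets the fibre over $b$ at an unknown sheet, hence the hypothesis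
on the whole fibre. -/
theorem eq_of_forall_fiber_eq {z b : ℂ} {r : ℕ → ℂ} (hr : (z, r) ∈ rootFamilies a) {ρ : ℝ}
    (hρ : 0 < ρ) (hρD : Metric.ball 0 ρ ⊆ leafDomain a z z) (hb : ‖b - z‖ < ρ ^ 2)
    (hbC : ∀ s, (b, s) ∈ rootFamilies a → φ (rootSumPoint ε (b, s)) = C) :
    φ (rootSumPoint ε (z, r)) = C := by
  obtain ⟨ζ, hζ⟩ := IsAlgClosed.exists_pow_nat_eq (b - z) two_pos
  have hζρ : ζ ∈ Metric.ball (0 : ℂ) ρ := by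
    rw [mem_ball_zero_iff]
    rw [← hζ, norm_pow] at hb
    exact lt_of_pow_lt_pow_left₀ 2 hρ.le hb
  have hm := leafRoots_mem hr (hρD hζρ)
  have h := eq_on_leaf ha hε hsa hV hEV hφc hφ hC hr (convex_ball (0 : ℂ) ρ).isPreconnected hρD
    hζρ (by
      rw [leafCurve]
      rw [hζ, add_sub_cancel] at hm ⊢
      exact hbC _ hm) 0 (Metric.mem_ball_self hρ)
  simpa [leafCurve, leafRoots_self_zero hr] using h

theorem eq_of_exists_eq (hex : ∃ p ∈ wermerSet a ε, φ p = C) : ∀ p ∈ wermerSet a ε, φ p = C := by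
  rw [wermerSet_eq_image hε (ha.summable hε hsa) hsa] at hex ⊢
  have hball : ∀ z, ∃ ρ > 0, Metric.ball 0 ρ ⊆ leafDomain a z z := fun z =>
    Metric.isOpen_iff.1 (isOpen_leafDomain (ha.finite_norm_sub_le z)) 0 zero_mem_leafDomain_self
  have hdense := dense_isOffLatticeLines ha.1
  obtain ⟨_, ⟨⟨z₀, r₀⟩, hr₀, rfl⟩, hC₀⟩ := hex
  rintro _ ⟨⟨z, r⟩, hr, rfl⟩
  obtain ⟨ρ₀, hρ₀, hD₀⟩ := hball z₀
  obtain ⟨ρ, hρ, hD⟩ := hball z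
  obtain ⟨b₀, hb₀, hb₀z⟩ := hdense.exists_dist_lt z₀ (pow_pos hρ₀ 2)
  rw [dist_comm, dist_eq_norm] at hb₀z
  obtain ⟨s₀, hs₀, hs₀C⟩ := exists_eq_of_ball_subset_leafDomain ha hε hsa hV hEV hφc hφ hC hr₀ hC₀
    hρ₀ hD₀ hb₀z
  obtain ⟨k, hk⟩ := ha.exists_norm_sub_lt_one z
  obtain ⟨t, ht, htC⟩ := exists_eq_over_lattice_point ha hε hsa hV hEV hφc hφ hC hb₀ hs₀ hs₀C k
  -- A generic `b` lies both in the unit disc about `a k`, where the leaf over `a k` reaches it, and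
  -- in the disc covered by the leaf at `z`.
  obtain ⟨b, ⟨hbz, hbk⟩, hb⟩ := hdense.inter_open_nonempty
    (Metric.ball z (ρ ^ 2) ∩ Metric.ball (a k) (1 ^ 2)) (Metric.isOpen_ball.inter Metric.isOpen_ball)
    ⟨z, Metric.mem_ball_self (pow_pos hρ 2), by simpa [dist_eq_norm] using hk⟩
  rw [mem_ball_iff_norm] at hbz hbk
  obtain ⟨s, hs, hsC⟩ := exists_eq_of_ball_subset_leafDomain ha hε hsa hV hEV hφc hφ hC ht htC
    one_pos (ball_subset_leafDomain_self fun j hj => ha.one_le_norm_sub hj.symm) hbk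
  exact eq_of_forall_fiber_eq ha hε hsa hV hEV hφc hφ hC hr hρ hD hbz fun s' hs' =>
    eq_on_fiber ha hε hsa hV hEV hφc hφ hC hb hs hsC hs'

end Liouville

theorem theorem6p1
    (a : ℕ → ℂ) (ha : IsLatticeEnumeration a)
    (ε : ℕ → ℝ) (hε_pos : ∀ k, 0 < ε k) (hε_anti : Antitone ε)
    (hε_fast : Summable fun k => ε k * √‖a k‖)
    (V : Set (ℂ × ℂ)) (hV : IsOpen V) (hEV : wermerSet a ε ⊆ V)
    (φ : ℂ × ℂ → ℝ) (hφ_cont : ContinuousOn φ V) (hφ_psh : PlurisubharmonicOn φ V)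
    (hφ_bdd : BddAbove (φ '' V)) :
    ∃ C : ℝ, ∀ p ∈ wermerSet a ε, φ p = C := by
  have hε : ∀ k, 0 ≤ ε k := fun k => (hε_pos k).le
  obtain ⟨p, hp, hmax⟩ := exists_isMaxOn_wermerSet ha hε hε_fast hV hEV hφ_cont hφ_psh hφ_bdd
  exact ⟨φ p, eq_of_exists_eq ha hε hε_fast hV hEV hφ_cont hφ_psh hmax ⟨p, hp, rfl⟩⟩
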